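/- For a lattice polytope $P\subseteq\mathbb{R}^N$ (the convex hull of a nonempty finite subset of $\mathbb{Z}^N$) let $E_P(m)=\#(mP\cap\mathbb{Z}^N)$, $m=0,1,2,\dots$, be the values of its Ehrhart polynomial at the non-negative integers. (a) For every positive integer $k$ there exist $N$ and a lattice polytope $P\subseteq\mathbb{R}^N$ such that $E_P(m)^2<E_P(m-1)\,E_P(m+1)$ for at least $k$ distinct positive integers $m$. (b) More precisely, for integers $q\ge 1$, $n\ge 2$ let $\mathscr{R}_{q,n}=\mathrm{conv}\{0,e_1,\dots,e_{d-1},(1,\dots,1,q,\dots,q,q+1)\}\subseteq\mathbb{R}^{d}$, $d=2n-1$, be the generalized Reeve simplex, where the last vertex has $n-1$ coordinates equal to $1$, followed by $n-1$ coordinates equal to $q$ and by one coordinate $q+1$. Define the join of polytopes $P_i\subseteq\mathbb{R}^{d_i}$ ($1\le i\le k$) as the convex hull of the union of the sets $\{(0,\dots,0,x,0,\dots,0;e_i):x\in P_i\}$ in $\mathbb{R}^{d_1}\times\cdots\times\mathbb{R}^{d_k}\times\mathbb{R}^k$, with $x$ in the $i$-th block. For every integer $k\ge 2$, put $n_i=3k-2+3(i-1)$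 for $1\le i\le k$. Then there exist positive integers $m_1,\dots,m_k$ such that the join $P$ of $\mathscr{R}_{m_1,n_1},\dots,\mathscr{R}_{m_k,n_k}$ is a lattice polytope of dimension $2(n_1+\cdots+n_k)-1$ and $$E_P(n_i-1)^2<E_P(n_i-2)\,E_P(n_i)\qquad\text{for every } i=1,\dots,k.$$ -/

import Mathlib

open scoped Pointwise

/-- A lattice polytope in `ℝ^ι`: the convex hull of a nonempty finite set of points of `ℤ^ι`. -/
def IsLatticePolytope {ι : Type*} (P : Set (ι → ℝ)) : Prop :=
  ∃ S : Finset (ι → ℤ), S.Nonempty ∧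
    P = convexHull ℝ ((fun (v : ι → ℤ) (j : ι) => (v j : ℝ)) '' (S : Set (ι → ℤ)))

/-- The Ehrhart function `E_P(m) = #(mP ∩ ℤ^ι)`. For a lattice polytope it is the evaluation at `m`
of the Ehrhart polynomial of `P` (at `m = 0` the dilate is the origin and the value is `1`). -/
noncomputable def ehrhart {ι : Type*} (P : Set (ι → ℝ)) (m : ℕ) : ℕ :=
  Set.ncard {x : ι → ℤ | (fun j => (x j : ℝ)) ∈ (m : ℝ) • P}

/-- The dimension of (the affine hull of) a nonempty set in `ℝ^ι`. -/
noncomputable def polytopeDim {ι : Type*} (P : Set (ι → ℝ)) : ℕ :=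
  Module.finrank ℝ (vectorSpan ℝ P)

/-- The last vertex `(1, …, 1, q, …, q, q + 1)` of the generalized Reeve simplex: `k - 1` entries
`1`, then `k - 1` entries `q`, then `q + 1`. -/
def reeveApex (q k : ℕ) : Fin (2 * k - 1) → ℝ := fun j =>
  if (j : ℕ) < k - 1 then 1 else if (j : ℕ) < 2 * k - 2 then (q : ℝ) else (q : ℝ) + 1

/-- The generalized Reeve simplex
`conv {0, e₁, …, e_{d-1}, (1, …, 1, q, …, q, q + 1)}` in `ℝ^d`, with `d = 2k - 1` and `k ≥ 2`. -/
def reeveSimplex (q k : ℕ) : Set (Fin (2 * k - 1) → ℝ) :=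
  convexHull ℝ
    ({0} ∪ {v | ∃ j : Fin (2 * k - 1), (j : ℕ) < 2 * k - 2 ∧ v = Pi.single j 1} ∪ {reeveApex q k})

/-- The inclusion of the `i`-th factor into `(⨁ j, ℝ^(κ j)) ⊕ ℝ^ι` used to form a join:
`x ↦ (0, …, 0, x, 0, …, 0; e_i)`. -/
def joinIncl {ι : Type*} [DecidableEq ι] {κ : ι → Type*} (i : ι) (x : κ i → ℝ) :
    (Σ j, κ j) ⊕ ι → ℝ :=
  Sum.elim (fun p => (Pi.single i x : ∀ j, κ j → ℝ) p.1 p.2) (Pi.single i 1)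

/-- The (lattice) join of a finite family of polytopes `P i` in `ℝ^(κ i)`: the convex hull of the
copies of the `P i` placed in pairwise skew affine subspaces, at heights the standard unit vectors
`e_i`. It lies in the affine hyperplane where the heights sum to `1`. -/
def latticeJoin {ι : Type*} [DecidableEq ι] {κ : ι → Type*} (P : ∀ i, Set (κ i → ℝ)) :
    Set ((Σ j, κ j) ⊕ ι → ℝ) :=
  convexHull ℝ (⋃ i, joinIncl i '' P i)

/-- The numbers `3k - 2, 3k + 1, …, 6k - 5` (indexed from `0` to `k - 1`). -/
def reeveIndex (k : ℕ) (i : Fin k) : ℕ := 3 * k - 2 + 3 * (i : ℕ)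

/-!
The vertices of the join of the generalized Reeve simplices `R_{q_i, n_i}` are integral and linearly
independent (`linearIndependent_joinVertex`). This gives the dimension, and it writes a lattice
point of the `m`-th dilate uniquely as a nonnegative combination of the vertices with coefficients
summing to `m`.

The `h^*`-polynomial of `R_{q, n}` is `1 + q t^n`; two consequences of this suffice.

* Solving for the coefficients in the `i`-th block shows that `q_i + 1` clears their denominators
  (`succ_mul_coeff_mem_range_intCast`). If the coefficient of the apex is not an integer, the
  coefficients of the block group into `n_i` pairs with positive integral sums, so the height of the
  point in that block is at least `n_i`. Hence in the `m`-th dilate all coefficients of the blocks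
  with `n_i > m` are integers (`coeff_mem_range_intCast`), and the number of lattice points is
  bounded in terms of the `q_j` with `n_j ≤ m` alone (`finite_and_ehrhart_le`).
* The `n_i`-th dilate contains `q_i` lattice points coming from the fundamental parallelepiped of the
  `i`-th simplex (`le_ehrhart`).

For a monotone sequence `n_i`, the value `E(n_i - 1)` is thus bounded independently of the `q_j`
with `j ≥ i`, while `E(n_i) ≥ q_i` and `E(n_i - 2) ≥ 1`. Choosing `q_i` recursively, each larger than
the square of the bound determined by its predecessors, gives the inequalities
(`exists_ehrhart_sq_lt`).
-/

/-! ### Vertices of the generalized Reeve simplex -/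

/-- The vertices of the generalized Reeve simplex as integral points, indexed by
`Option (Fin (2 * n - 1))`: `none` is the origin, the last index is the apex, and every other index
gives the corresponding standard unit vector. -/
def reeveVertex (q n : ℕ) : Option (Fin (2 * n - 1)) → Fin (2 * n - 1) → ℤ
  | none => 0
  | some c => if (c : ℕ) < 2 * n - 2 then Pi.single c 1 else fun j =>
      if (j : ℕ) < n - 1 then 1 else if (j : ℕ) < 2 * n - 2 then (q : ℤ) else (q : ℤ) + 1

/-- The coordinates of a linear combination of the vertices; `l` is the index of the apex. -/
theorem sum_mul_reeveVertex {q n : ℕ} (w : Option (Fin (2 * n - 1)) → ℝ)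
    {l : Fin (2 * n - 1)} (hl : (l : ℕ) = 2 * n - 2) (c : Fin (2 * n - 1)) :
    ∑ o, w o * (reeveVertex q n o c : ℝ) =
      (if (c : ℕ) < 2 * n - 2 then w (some c) else 0) + w (some l) * reeveApex q n c := by
  have hterm : ∀ d : Fin (2 * n - 1), w (some d) * (reeveVertex q n (some d) c : ℝ) =
      (if d = c then (if (c : ℕ) < 2 * n - 2 then w (some c) else 0) else 0) +
        (if d = l then w (some l) * reeveApex q n c else 0) := by
    intro d
    by_cases hd : (d : ℕ) < 2 * n - 2
    · have hdl : d ≠ l := by rintro rfl; omega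
      by_cases hdc : d = c
      · subst hdc
        simp [reeveVertex, hd, hdl]
      · simp [reeveVertex, hd, hdl, hdc]
    · have hdl : d = l := by ext; omega
      subst hdl
      have : (if d = c then (if (c : ℕ) < 2 * n - 2 then w (some c) else 0) else 0) = 0 := by
        split_ifs with h1 h2
        · subst h1; omega
        all_goals rfl
      rw [this]
      simp only [reeveVertex, reeveApex]
      rw [if_neg hd]
      split_ifs <;> simp
  rw [Fintype.sum_option]
  simp only [hterm, Finset.sum_add_distrib]
  simp [reeveVertex]

theorem reeveSimplex_eq_convexHull_range {q n : ℕ} (hn : 1 ≤ n) :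
    reeveSimplex q n =
      convexHull ℝ (Set.range fun o (c : Fin (2 * n - 1)) => (reeveVertex q n o c : ℝ)) := by
  have hapex : ∀ c : Fin (2 * n - 1), ¬ (c : ℕ) < 2 * n - 2 →
      (fun j => (reeveVertex q n (some c) j : ℝ)) = reeveApex q n := by
    intro c hc
    ext j
    simp only [reeveVertex, reeveApex]
    rw [if_neg hc]
    split_ifs <;> simp
  have hsingle : ∀ c : Fin (2 * n - 1), (c : ℕ) < 2 * n - 2 →
      (fun j => (reeveVertex q n (some c) j : ℝ)) = Pi.single c 1 := by
    intro c hc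
    ext j
    simp only [reeveVertex, hc, if_true, Pi.single_apply]
    split_ifs <;> simp
  have hzero : (fun j => (reeveVertex q n none j : ℝ)) = 0 := by
    ext j; simp [reeveVertex]
  unfold reeveSimplex
  congr 1
  ext v
  simp only [Set.mem_union, Set.mem_singleton_iff, Set.mem_ofPred_eq, Set.mem_range]
  constructor
  · rintro ((rfl | ⟨j, hj, rfl⟩) | rfl)
    · exact ⟨none, hzero⟩
    · exact ⟨some j, hsingle j hj⟩
    · exact ⟨some ⟨2 * n - 2, by omega⟩, hapex _ (lt_irrefl _)⟩
  · rintro ⟨o, rfl⟩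
    cases o with
    | none => exact .inl (.inl hzero)
    | some c =>
      by_cases hc : (c : ℕ) < 2 * n - 2
      · exact .inl (.inr ⟨c, hc, hsingle c hc⟩)
      · exact .inr (hapex c hc)

/-! ### Vertices of the join -/

section Join

variable {ι : Type*} [DecidableEq ι]

/-- The vertex of the join of the simplices `reeveSimplex (q i) (n i)` that comes from the vertex
`v.2` of the `v.1`-th simplex, as an integral point. -/
def joinVertex (q n : ι → ℕ) (v : Σ i, Option (Fin (2 * n i - 1))) :
    (Σ i, Fin (2 * n i - 1)) ⊕ ι → ℤ :=
  Sum.elim (fun p => (Pi.single v.1 (reeveVertex (q v.1) (n v.1) v.2) :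
    ∀ i, Fin (2 * n i - 1) → ℤ) p.1 p.2) (Pi.single v.1 1)

theorem joinVertex_cast (q n : ι → ℕ) (v : Σ i, Option (Fin (2 * n i - 1))) :
    (fun p => (joinVertex q n v p : ℝ)) =
      joinIncl v.1 (fun c => (reeveVertex (q v.1) (n v.1) v.2 c : ℝ)) := by
  obtain ⟨i, o⟩ := v
  ext p
  rcases p with ⟨j, c⟩ | j
  · by_cases h : j = i
    · subst h; simp [joinVertex, joinIncl]
    · simp [joinVertex, joinIncl, h]
  · by_cases h : j = i
    · subst h; simp [joinVertex, joinIncl]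
    · simp [joinVertex, joinIncl, h]

theorem joinIncl_combo {κ : ι → Type*} (i : ι) (x y : κ i → ℝ) {a b : ℝ} (hab : a + b = 1) :
    joinIncl i (a • x + b • y) = a • joinIncl (κ := κ) i x + b • joinIncl i y := by
  ext p
  rcases p with ⟨j, c⟩ | j
  · by_cases h : j = i
    · subst h; simp [joinIncl]
    · simp [joinIncl, h]
  · by_cases h : j = i
    · subst h; simp [joinIncl, hab]
    · simp [joinIncl, h]

theorem latticeJoin_reeveSimplex {q n : ι → ℕ} (hn : ∀ i, 1 ≤ n i) :
    (latticeJoin fun i => reeveSimplex (q i) (n i)) =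
      convexHull ℝ (Set.range fun v p => (joinVertex q n v p : ℝ)) := by
  apply Set.Subset.antisymm
  · refine convexHull_min (Set.iUnion_subset fun i => Set.image_subset_iff.2 ?_)
      (convex_convexHull ℝ _)
    dsimp only
    rw [reeveSimplex_eq_convexHull_range (hn i)]
    refine convexHull_min ?_ ?_
    · rintro _ ⟨o, rfl⟩
      exact subset_convexHull ℝ _ ⟨⟨i, o⟩, joinVertex_cast q n ⟨i, o⟩⟩
    · intro x hx y hy a b ha hb hab
      simp only [Set.mem_preimage] at *
      rw [joinIncl_combo (κ := fun j => Fin (2 * n j - 1)) i x y hab]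
      exact convex_convexHull ℝ _ hx hy ha hb hab
  · refine convexHull_mono ?_
    rintro _ ⟨⟨i, o⟩, rfl⟩
    refine Set.mem_iUnion.2 ⟨i, _, ?_, (joinVertex_cast q n ⟨i, o⟩).symm⟩
    dsimp only
    rw [reeveSimplex_eq_convexHull_range (hn i)]
    exact subset_convexHull ℝ _ ⟨o, rfl⟩

variable [Fintype ι]

theorem sum_mul_joinVertex_inl {q n : ι → ℕ} (w : (Σ i, Option (Fin (2 * n i - 1))) → ℝ)
    (i : ι) {l : Fin (2 * n i - 1)} (hl : (l : ℕ) = 2 * n i - 2) (c : Fin (2 * n i - 1)) :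
    ∑ v, w v * (joinVertex q n v (.inl ⟨i, c⟩) : ℝ) =
      (if (c : ℕ) < 2 * n i - 2 then w ⟨i, some c⟩ else 0) +
        w ⟨i, some l⟩ * reeveApex (q i) (n i) c := by
  rw [← sum_mul_reeveVertex (fun o => w ⟨i, o⟩) hl c, Fintype.sum_sigma,
    Finset.sum_eq_single i]
  · simp [joinVertex]
  · intro j _ hj
    refine Finset.sum_eq_zero fun o _ => ?_
    simp [joinVertex, Pi.single_eq_of_ne (Ne.symm hj)]
  · simp

theorem sum_mul_joinVertex_inr {q n : ι → ℕ} (w : (Σ i, Option (Fin (2 * n i - 1))) → ℝ) (i : ι) :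
    ∑ v, w v * (joinVertex q n v (.inr i) : ℝ) = ∑ o, w ⟨i, o⟩ := by
  rw [Fintype.sum_sigma, Finset.sum_eq_single i]
  · simp [joinVertex]
  · intro j _ hj
    refine Finset.sum_eq_zero fun o _ => ?_
    simp [joinVertex, Pi.single_eq_of_ne (Ne.symm hj)]
  · simp

theorem linearIndependent_joinVertex {q n : ι → ℕ} (hn : ∀ i, 1 ≤ n i) :
    LinearIndependent ℝ fun v p => (joinVertex q n v p : ℝ) := by
  rw [Fintype.linearIndependent_iff]
  intro w hw
  have hw' : ∀ p, ∑ v, w v * (joinVertex q n v p : ℝ) = 0 := fun p => by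
    simpa using congrFun hw p
  have hsome : ∀ i c, w ⟨i, some c⟩ = 0 := by
    intro i
    have hl : ((⟨2 * n i - 2, by have := hn i; omega⟩ : Fin (2 * n i - 1)) : ℕ) =
      2 * n i - 2 := rfl
    set l : Fin (2 * n i - 1) := ⟨2 * n i - 2, by have := hn i; omega⟩
    have hwl : w ⟨i, some l⟩ = 0 := by
      have h := hw' (.inl ⟨i, l⟩)
      rw [sum_mul_joinVertex_inl w i hl] at h
      have h2 : reeveApex (q i) (n i) l = q i + 1 := by
        simp only [reeveApex, hl]
        rw [if_neg (by omega), if_neg (by omega)]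
      rw [hl, if_neg (lt_irrefl _), h2, zero_add] at h
      exact (mul_eq_zero.1 h).resolve_right (by positivity)
    intro c
    by_cases hc : (c : ℕ) < 2 * n i - 2
    · have h := hw' (.inl ⟨i, c⟩)
      rw [sum_mul_joinVertex_inl w i hl, if_pos hc, hwl] at h
      simpa using h
    · have : c = l := by ext; omega
      rw [this, hwl]
  rintro ⟨i, o⟩
  cases o with
  | some c => exact hsome i c
  | none =>
    have h := hw' (.inr i)
    rw [sum_mul_joinVertex_inr, Fintype.sum_option] at h
    simpa [hsome] using h

theorem isLatticePolytope_latticeJoin_reeveSimplex [Nonempty ι] {q n : ι → ℕ}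
    (hn : ∀ i, 1 ≤ n i) :
    IsLatticePolytope (latticeJoin fun i => reeveSimplex (q i) (n i)) := by
  classical
  refine ⟨Finset.univ.image (joinVertex q n), ?_, ?_⟩
  · exact (Finset.univ_nonempty_iff.2 ⟨⟨Classical.arbitrary ι, none⟩⟩).image _
  · rw [latticeJoin_reeveSimplex hn, Finset.coe_image, Finset.coe_univ, Set.image_univ,
      ← Set.range_comp]
    rfl

theorem polytopeDim_latticeJoin_reeveSimplex [Nonempty ι] {q n : ι → ℕ} (hn : ∀ i, 1 ≤ n i) :
    polytopeDim (latticeJoin fun i => reeveSimplex (q i) (n i)) + 1 = ∑ i, 2 * n i := by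
  have hcard : Fintype.card (Σ i, Option (Fin (2 * n i - 1))) = ∑ i, 2 * n i := by
    rw [Fintype.card_sigma]
    refine Finset.sum_congr rfl fun i _ => ?_
    have := hn i
    simp only [Fintype.card_option, Fintype.card_fin]
    omega
  have : Nonempty (Σ i, Option (Fin (2 * n i - 1))) := ⟨⟨Classical.arbitrary ι, none⟩⟩
  rw [polytopeDim, latticeJoin_reeveSimplex hn, ← direction_affineSpan, affineSpan_convexHull,
    direction_affineSpan, ← hcard]
  exact (linearIndependent_joinVertex hn).affineIndependent.finrank_vectorSpan_add_one

end Join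

/-! ### Integrality of the coefficients of lattice points -/

theorem mem_smul_convexHull_range_iff {V E : Type*} [Fintype V] [AddCommGroup E] [Module ℝ E]
    {v : V → E} {r : ℝ} (hr : 0 < r) {x : E} :
    x ∈ r • convexHull ℝ (Set.range v) ↔
      ∃ w : V → ℝ, (∀ a, 0 ≤ w a) ∧ ∑ a, w a = r ∧ ∑ a, w a • v a = x := by
  constructor
  · rintro ⟨y, hy, rfl⟩
    have hsub : convexHull ℝ (Set.range v) ⊆
        {y | ∃ w : V → ℝ, (∀ a, 0 ≤ w a) ∧ ∑ a, w a = 1 ∧ ∑ a, w a • v a = y} := by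
      classical
      refine convexHull_min ?_ ?_
      · rintro _ ⟨a, rfl⟩
        refine ⟨Pi.single a 1, fun b => ?_, by simp, by simp [Pi.single_apply]⟩
        rw [Pi.single_apply]; split_ifs <;> simp
      · rintro _ ⟨w, hw, hw1, rfl⟩ _ ⟨w', hw', hw1', rfl⟩ s t hs ht hst
        refine ⟨fun a => s * w a + t * w' a, fun a => ?_, ?_, ?_⟩
        · have := hw a; have := hw' a; positivity
        · rw [Finset.sum_add_distrib, ← Finset.mul_sum, ← Finset.mul_sum, hw1, hw1']
          simpa using hst
        · simp only [add_smul, Finset.sum_add_distrib, Finset.smul_sum, mul_smul]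
    obtain ⟨w, hw, hw1, rfl⟩ := hsub hy
    refine ⟨fun a => r * w a, fun a => mul_nonneg hr.le (hw a), ?_, ?_⟩
    · rw [← Finset.mul_sum, hw1, mul_one]
    · simp [Finset.smul_sum, mul_smul]
  · rintro ⟨w, hw, hw1, rfl⟩
    refine Set.mem_smul_set.2 ⟨∑ a, (r⁻¹ * w a) • v a, ?_, ?_⟩
    · refine mem_convexHull_of_exists_fintype (fun a => r⁻¹ * w a) v
        (fun a => mul_nonneg (by positivity) (hw a)) ?_ (fun a => ⟨a, rfl⟩) rfl
      rw [← Finset.mul_sum, hw1, inv_mul_cancel₀ hr.ne']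
    · rw [Finset.smul_sum]
      refine Finset.sum_congr rfl fun a _ => ?_
      rw [smul_smul, ← mul_assoc, mul_inv_cancel₀ hr.ne', one_mul]

/-- Pairs each of the first `n - 1` terms with the corresponding one of the next `n - 1` terms. -/
theorem sum_fin_eq_sum_pairs {n : ℕ} (hn : 1 ≤ n) (f : ℕ → ℝ) :
    ∑ c : Fin (2 * n - 1), f c =
      ∑ c ∈ Finset.range (n - 1), (f c + f (n - 1 + c)) + f (2 * n - 2) := by
  obtain ⟨p, rfl⟩ : ∃ p, n = p + 1 := ⟨n - 1, by omega⟩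
  rw [← Finset.sum_range, show 2 * (p + 1) - 1 = p + p + 1 by omega, Finset.sum_range_succ,
    Finset.sum_range_add, Finset.sum_add_distrib, show 2 * (p + 1) - 2 = p + p by omega]
  rfl

section Integrality

/-
Here `w` is the family of coefficients of a lattice point with respect to the vertices of one
simplex, `x` its coordinates, `h` its height, and `l` the index of the apex. Integrality of a real
number is expressed as membership in the subring `(Int.castRingHom ℝ).range`.
-/

variable {q n : ℕ} {w : Option (Fin (2 * n - 1)) → ℝ} {l : Fin (2 * n - 1)}
  {x : Fin (2 * n - 1) → ℤ} {h : ℤ}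

theorem reeveApex_mem_range_intCast (q n : ℕ) (c : Fin (2 * n - 1)) :
    reeveApex q n c ∈ (Int.castRingHom ℝ).range := by
  unfold reeveApex
  split_ifs
  · exact one_mem _
  · exact natCast_mem _ _
  · exact add_mem (natCast_mem _ _) (one_mem _)

theorem intCast_mem_range_castRingHom (z : ℤ) : (z : ℝ) ∈ (Int.castRingHom ℝ).range := ⟨z, rfl⟩

/-- An integer `κ` that clears the denominator of the apex coefficient clears all denominators. -/
theorem mul_coeff_mem_range_intCast (hl : (l : ℕ) = 2 * n - 2)
    (hx : ∀ c : Fin (2 * n - 1), (if (c : ℕ) < 2 * n - 2 then w (some c) else 0) +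
      w (some l) * reeveApex q n c = x c)
    (hh : ∑ o, w o = h) {κ : ℝ} (hκ : κ ∈ (Int.castRingHom ℝ).range)
    (hκl : κ * w (some l) ∈ (Int.castRingHom ℝ).range) (o : Option (Fin (2 * n - 1))) :
    κ * w o ∈ (Int.castRingHom ℝ).range := by
  have hsome : ∀ c, κ * w (some c) ∈ (Int.castRingHom ℝ).range := by
    intro c
    by_cases hc : (c : ℕ) < 2 * n - 2
    · have h1 := hx c
      rw [if_pos hc] at h1
      have h2 : κ * w (some c) = κ * x c - κ * w (some l) * reeveApex q n c := by
        rw [← h1]; ring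
      rw [h2]
      exact sub_mem (mul_mem hκ (intCast_mem_range_castRingHom _))
        (mul_mem hκl (reeveApex_mem_range_intCast q n c))
    · have : c = l := by ext; omega
      rwa [this]
  cases o with
  | some c => exact hsome c
  | none =>
    rw [Fintype.sum_option] at hh
    have h2 : κ * w none = κ * h - ∑ c, κ * w (some c) := by
      rw [← hh, ← Finset.mul_sum]; ring
    rw [h2]
    exact sub_mem (mul_mem hκ (intCast_mem_range_castRingHom _)) (sum_mem fun c _ => hsome c)

/-- The last coordinate of the point is `q + 1` times the apex coefficient. -/
theorem succ_mul_coeff_mem_range_intCast (hl : (l : ℕ) = 2 * n - 2)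
    (hx : ∀ c : Fin (2 * n - 1), (if (c : ℕ) < 2 * n - 2 then w (some c) else 0) +
      w (some l) * reeveApex q n c = x c)
    (hh : ∑ o, w o = h) (o : Option (Fin (2 * n - 1))) :
    ((q : ℝ) + 1) * w o ∈ (Int.castRingHom ℝ).range := by
  refine mul_coeff_mem_range_intCast hl hx hh (add_mem (natCast_mem _ _) (one_mem _)) ?_ o
  have h1 := hx l
  have h2 : reeveApex q n l = q + 1 := by
    simp only [reeveApex, hl]
    rw [if_neg (by omega), if_neg (by omega)]
  rw [hl, if_neg (lt_irrefl _), h2, zero_add, mul_comm] at h1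
  exact ⟨x l, h1.symm⟩

theorem one_le_of_mem_range_intCast {r : ℝ} (hr : r ∈ (Int.castRingHom ℝ).range) (h0 : 0 < r) :
    1 ≤ r := by
  obtain ⟨z, rfl⟩ := hr
  rw [eq_intCast] at *
  exact_mod_cast Int.cast_pos.1 h0

/-- A lattice point of height less than `n` over the generalized Reeve simplex is an integral
combination of the vertices: with a non-integral apex coefficient, the coefficients of the `c`-th
and the `(n - 1 + c)`-th unit vector have a positive integral sum for each `c < n - 1`, and so have
the coefficients of the origin and the apex, which makes the height at least `n`. -/
theorem coeff_mem_range_intCast (hl : (l : ℕ) = 2 * n - 2) (hw : ∀ o, 0 ≤ w o)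
    (hx : ∀ c : Fin (2 * n - 1), (if (c : ℕ) < 2 * n - 2 then w (some c) else 0) +
      w (some l) * reeveApex q n c = x c)
    (hh : ∑ o, w o = h) (hhn : h < n) (o : Option (Fin (2 * n - 1))) :
    w o ∈ (Int.castRingHom ℝ).range := by
  suffices hwl : w (some l) ∈ (Int.castRingHom ℝ).range by
    simpa using mul_coeff_mem_range_intCast hl hx hh (one_mem _) (by simpa using hwl) o
  by_contra hwl
  have hn : 1 ≤ n := by have := l.2; omega
  have hqwl := succ_mul_coeff_mem_range_intCast hl hx hh (some l)
  have ha0 : 0 < w (some l) := lt_of_le_of_ne (hw _) fun h0 => hwl (h0 ▸ zero_mem _)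
  set f : ℕ → ℝ := fun c => if hc : c < 2 * n - 1 then w (some ⟨c, hc⟩) else 0 with hf
  have hfw : ∀ c : Fin (2 * n - 1), f c = w (some c) := fun c => by simp [hf, c.2]
  have hfx : ∀ c, c < n - 1 → f c + w (some l) ∈ (Int.castRingHom ℝ).range := by
    intro c hc
    have h1 := hx ⟨c, by omega⟩
    rw [if_pos (by dsimp only; omega), ← hfw] at h1
    simp only [reeveApex, if_pos hc, mul_one] at h1
    exact ⟨_, h1.symm⟩
  have hfx' : ∀ c, c < n - 1 → f (n - 1 + c) - w (some l) ∈ (Int.castRingHom ℝ).range := by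
    intro c hc
    have h1 := hx ⟨n - 1 + c, by omega⟩
    rw [if_pos (by dsimp only; omega), ← hfw] at h1
    simp only [reeveApex] at h1
    rw [if_neg (by omega), if_pos (by omega)] at h1
    have h2 : f (n - 1 + c) - w (some l) =
        x ⟨n - 1 + c, by omega⟩ - ((q : ℝ) + 1) * w (some l) := by
      rw [← h1]; ring
    rw [h2]
    exact sub_mem (intCast_mem_range_castRingHom _) hqwl
  have hf0 : ∀ c, 0 ≤ f c := fun c => by
    simp only [hf]; split_ifs
    · exact hw _
    · exact le_rfl
  have hpair : ∀ c, c < n - 1 → f c + f (n - 1 + c) ∈ (Int.castRingHom ℝ).range := by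
    intro c hc
    have h2 : f c + f (n - 1 + c) = (f c + w (some l)) + (f (n - 1 + c) - w (some l)) := by ring
    rw [h2]
    exact add_mem (hfx c hc) (hfx' c hc)
  have hpair1 : ∀ c ∈ Finset.range (n - 1), 1 ≤ f c + f (n - 1 + c) := by
    intro c hc
    rw [Finset.mem_range] at hc
    refine one_le_of_mem_range_intCast (hpair c hc) ?_
    have : 0 < f c := lt_of_le_of_ne (hf0 c) fun h0 => hwl (by
      have := hfx c hc
      rwa [← h0, zero_add] at this)
    linarith [hf0 (n - 1 + c)]
  have hsum := hh
  have hfl : f (2 * n - 2) = w (some l) := by rw [← hfw l, hl]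
  rw [Fintype.sum_option, ← Finset.sum_congr rfl fun c _ => hfw c, sum_fin_eq_sum_pairs hn f,
    hfl] at hsum
  have hlast : w none + w (some l) ∈ (Int.castRingHom ℝ).range := by
    have h2 : w none + w (some l) =
        h - ∑ c ∈ Finset.range (n - 1), (f c + f (n - 1 + c)) := by
      rw [← hsum]; ring
    rw [h2]
    exact sub_mem (intCast_mem_range_castRingHom _)
      (sum_mem fun c hc => hpair c (Finset.mem_range.1 hc))
  have hlast1 := one_le_of_mem_range_intCast hlast (by linarith [hw none])
  have hle := Finset.sum_le_sum hpair1
  simp only [Finset.sum_const, Finset.card_range, nsmul_eq_mul, mul_one] at hle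
  have hcast : ((n - 1 : ℕ) : ℝ) = n - 1 := by push_cast [hn]; ring
  have hlt : (h : ℝ) < n := by exact_mod_cast hhn
  linarith

end Integrality

/-! ### Bounds for the Ehrhart function of the join -/

section Count

variable {ι : Type*} [DecidableEq ι] [Fintype ι] {q n : ι → ℕ}

theorem mem_smul_latticeJoin_reeveSimplex_iff (hn : ∀ i, 1 ≤ n i) {m : ℕ} (hm : 1 ≤ m)
    {x : (Σ i, Fin (2 * n i - 1)) ⊕ ι → ℝ} :
    x ∈ (m : ℝ) • (latticeJoin fun i => reeveSimplex (q i) (n i)) ↔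
      ∃ w : (Σ i, Option (Fin (2 * n i - 1))) → ℝ, (∀ v, 0 ≤ w v) ∧ ∑ v, w v = m ∧
        ∀ p, ∑ v, w v * (joinVertex q n v p : ℝ) = x p := by
  rw [latticeJoin_reeveSimplex hn, mem_smul_convexHull_range_iff (by exact_mod_cast hm)]
  simp only [funext_iff, Finset.sum_apply, Pi.smul_apply, smul_eq_mul]

/-- If `Q` is a multiple of `q i + 1` whenever `n i ≤ m`, then the coefficients of the lattice points
of the `m`-th dilate lie in `(1 / Q) ℤ ∩ [0, m]`. The bound does not involve the other `q i`. -/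
theorem finite_and_ehrhart_le (hn : ∀ i, 1 ≤ n i) {m Q : ℕ} (hm : 1 ≤ m) (hQ : 1 ≤ Q)
    (hqQ : ∀ i, q i + 1 ∣ Q ∨ m < n i) :
    {x : (Σ i, Fin (2 * n i - 1)) ⊕ ι → ℤ | (fun p => (x p : ℝ)) ∈
        (m : ℝ) • (latticeJoin fun i => reeveSimplex (q i) (n i))}.Finite ∧
      ehrhart (latticeJoin fun i => reeveSimplex (q i) (n i)) m ≤
        (m * Q + 1) ^ Fintype.card (Σ i, Option (Fin (2 * n i - 1))) := by
  classical
  let F : ((Σ i, Option (Fin (2 * n i - 1))) → Fin (m * Q + 1)) →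
      (Σ i, Fin (2 * n i - 1)) ⊕ ι → ℤ :=
    -- The floor only serves to make the value integral; it is exact on the points that matter.
    fun g p => ⌊∑ v, ((g v : ℕ) : ℝ) / Q * (joinVertex q n v p : ℝ)⌋
  have hQ0 : (0 : ℝ) < Q := by exact_mod_cast hQ
  have hsub : {x : (Σ i, Fin (2 * n i - 1)) ⊕ ι → ℤ | (fun p => (x p : ℝ)) ∈
      (m : ℝ) • (latticeJoin fun i => reeveSimplex (q i) (n i))} ⊆ F '' Set.univ := by
    intro x hx
    rw [Set.mem_ofPred_eq, mem_smul_latticeJoin_reeveSimplex_iff hn hm] at hx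
    obtain ⟨w, hw, hwm, hwx⟩ := hx
    have hint : ∀ v, (Q : ℝ) * w v ∈ (Int.castRingHom ℝ).range := by
      rintro ⟨i, o⟩
      have hl : ((⟨2 * n i - 2, by have := hn i; omega⟩ : Fin (2 * n i - 1)) : ℕ) =
        2 * n i - 2 := rfl
      set l : Fin (2 * n i - 1) := ⟨2 * n i - 2, by have := hn i; omega⟩
      have hx : ∀ c : Fin (2 * n i - 1), (if (c : ℕ) < 2 * n i - 2 then w ⟨i, some c⟩ else 0) +
          w ⟨i, some l⟩ * reeveApex (q i) (n i) c = x (.inl ⟨i, c⟩) := fun c => by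
        rw [← sum_mul_joinVertex_inl w i hl, hwx]
      have hh : ∑ o, w ⟨i, o⟩ = x (.inr i) := by
        rw [← sum_mul_joinVertex_inr (q := q) w i, hwx]
      rcases hqQ i with ⟨Q', hQ'⟩ | hmn
      · have h1 : (Q : ℝ) * w ⟨i, o⟩ = Q' * (((q i : ℝ) + 1) * w ⟨i, o⟩) := by
          rw [hQ']; push_cast; ring
        rw [h1]
        exact mul_mem (natCast_mem _ _)
          (succ_mul_coeff_mem_range_intCast (w := fun o => w ⟨i, o⟩) hl hx hh o)
      · have hlt : x (.inr i) < n i := by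
          have h1 : ∑ o, w ⟨i, o⟩ ≤ m := by
            rw [← hwm, Fintype.sum_sigma]
            exact Finset.single_le_sum (f := fun i => ∑ o, w ⟨i, o⟩)
              (fun j _ => Finset.sum_nonneg fun o _ => hw _) (Finset.mem_univ i)
          rw [hh] at h1
          have h2 : x (.inr i) ≤ m := by exact_mod_cast h1
          omega
        exact mul_mem (natCast_mem _ _)
          (coeff_mem_range_intCast (w := fun o => w ⟨i, o⟩) hl (fun o => hw _) hx hh hlt o)
    have hnat : ∀ v, ∃ g : Fin (m * Q + 1), ((g : ℕ) : ℝ) = Q * w v := by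
      intro v
      obtain ⟨z, hz⟩ := hint v
      rw [eq_intCast] at hz
      have hz0 : 0 ≤ z := by
        have : (0 : ℝ) ≤ z := hz ▸ mul_nonneg hQ0.le (hw v)
        exact_mod_cast this
      obtain ⟨a, rfl⟩ := Int.eq_ofNat_of_zero_le hz0
      rw [Int.cast_natCast] at hz
      have hwv : w v ≤ m := hwm ▸ Finset.single_le_sum (fun v _ => hw v) (Finset.mem_univ v)
      have ha : a ≤ m * Q := by
        have : (a : ℝ) ≤ m * Q := by rw [hz]; nlinarith
        exact_mod_cast this
      exact ⟨⟨a, by omega⟩, hz⟩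
    choose g hg using hnat
    refine ⟨g, trivial, ?_⟩
    ext p
    have h1 : ∀ v, ((g v : ℕ) : ℝ) / Q = w v := fun v => by
      rw [hg, mul_div_cancel_left₀ _ hQ0.ne']
    simp only [F, h1, hwx, Int.floor_intCast]
  have hfin : (F '' Set.univ).Finite := Set.toFinite _
  refine ⟨hfin.subset hsub, (Set.ncard_le_ncard hsub hfin).trans
    ((Set.ncard_image_le Set.finite_univ).trans_eq ?_)⟩
  rw [Set.ncard_univ, Nat.card_eq_fintype_card]
  simp only [Fintype.card_pi, Fintype.card_fin, Finset.prod_const, Finset.card_univ]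

theorem finite_lattice_points (hn : ∀ i, 1 ≤ n i) {m : ℕ} (hm : 1 ≤ m) :
    {x : (Σ i, Fin (2 * n i - 1)) ⊕ ι → ℤ | (fun p => (x p : ℝ)) ∈
        (m : ℝ) • (latticeJoin fun i => reeveSimplex (q i) (n i))}.Finite :=
  (finite_and_ehrhart_le hn hm (Q := ∏ i, (q i + 1))
    (Finset.one_le_prod' fun i _ => by omega)
    fun i => .inl (Finset.dvd_prod_of_mem _ (Finset.mem_univ i))).1

theorem one_le_ehrhart [Nonempty ι] (hn : ∀ i, 1 ≤ n i) {m : ℕ} (hm : 1 ≤ m) :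
    1 ≤ ehrhart (latticeJoin fun i => reeveSimplex (q i) (n i)) m := by
  refine (Set.ncard_pos (finite_lattice_points hn hm)).2 ?_
  let v : Σ i, Option (Fin (2 * n i - 1)) := ⟨Classical.arbitrary ι, none⟩
  refine ⟨fun p => m * joinVertex q n v p, ?_⟩
  rw [Set.mem_ofPred_eq, latticeJoin_reeveSimplex hn]
  refine Set.mem_smul_set.2 ⟨_, subset_convexHull ℝ _ ⟨v, rfl⟩, ?_⟩
  ext p
  simp

/-- The coefficients of a point over the generalized Reeve simplex, with apex coefficient `t`; for
`t = a / (q + 1)` and `1 ≤ a ≤ q` it is a lattice point of the fundamental parallelepiped. -/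
def fundamentalCoeff (n : ℕ) (t : ℝ) : Option (Fin (2 * n - 1)) → ℝ
  | none => 1 - t
  | some c => if (c : ℕ) < n - 1 then 1 - t else t

theorem sum_fundamentalCoeff {n : ℕ} (hn : 1 ≤ n) (t : ℝ) : ∑ o, fundamentalCoeff n t o = n := by
  rw [Fintype.sum_option]
  simp only [fundamentalCoeff]
  rw [sum_fin_eq_sum_pairs hn fun c => if c < n - 1 then 1 - t else t,
    Finset.sum_congr rfl (g := fun _ => (1 : ℝ)), if_neg (by omega)]
  · simp only [Finset.sum_const, Finset.card_range, nsmul_eq_mul, mul_one]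
    push_cast [hn]; ring
  · intro c hc
    rw [Finset.mem_range] at hc
    rw [if_pos hc, if_neg (by omega)]; ring

/-- The points `(1, …, 1, a, …, a)` with `n i - 1` entries `1` and `1 ≤ a ≤ q i` belong to the
`n i`-th dilate of the `i`-th simplex. -/
theorem le_ehrhart (hn : ∀ i, 1 ≤ n i) (i : ι) :
    q i ≤ ehrhart (latticeJoin fun i => reeveSimplex (q i) (n i)) (n i) := by
  let X : ℕ → (Σ i, Fin (2 * n i - 1)) ⊕ ι → ℤ := fun a =>
    Sum.elim (fun p => if p.1 = i then (if (p.2 : ℕ) < n i - 1 then 1 else (a : ℤ)) else 0)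
      (fun j => if j = i then (n i : ℤ) else 0)
  have hlast : 2 * n i - 2 < 2 * n i - 1 := by have := hn i; omega
  have hinj : Function.Injective X := by
    intro a b hab
    have := congrFun hab (.inl ⟨i, ⟨2 * n i - 2, hlast⟩⟩)
    simp only [X, Sum.elim_inl, if_true] at this
    rw [if_neg (by omega), if_neg (by omega)] at this
    exact_mod_cast this
  have hsub : X '' (Finset.Icc 1 (q i) : Set ℕ) ⊆
      {x : (Σ i, Fin (2 * n i - 1)) ⊕ ι → ℤ | (fun p => (x p : ℝ)) ∈
        (n i : ℝ) • (latticeJoin fun i => reeveSimplex (q i) (n i))} := by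
    rintro _ ⟨a, ha, rfl⟩
    rw [Finset.coe_Icc, Set.mem_Icc] at ha
    have hq1 : (0 : ℝ) < (q i : ℝ) + 1 := by positivity
    set t : ℝ := a / ((q i : ℝ) + 1) with ht
    have hta : t * ((q i : ℝ) + 1) = a := div_mul_cancel₀ _ hq1.ne'
    have ht0 : 0 ≤ t := by positivity
    have ht1 : t ≤ 1 := by
      rw [ht, div_le_one hq1]
      have : (a : ℝ) ≤ q i := by exact_mod_cast ha.2
      linarith
    rw [Set.mem_ofPred_eq, mem_smul_latticeJoin_reeveSimplex_iff hn (hn i)]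
    let w : (Σ i, Option (Fin (2 * n i - 1))) → ℝ := fun v =>
      if v.1 = i then fundamentalCoeff (n v.1) t v.2 else 0
    have hsum : ∀ j, ∑ o, w ⟨j, o⟩ = if j = i then (n i : ℝ) else 0 := by
      intro j
      by_cases hj : j = i
      · subst hj
        simp only [w, if_true, sum_fundamentalCoeff (hn j)]
      · simp [w, hj]
    refine ⟨w, ?_, ?_, ?_⟩
    · rintro ⟨j, o⟩
      simp only [w]
      split_ifs
      · cases o with
        | none => simpa [fundamentalCoeff] using ht1
        | some c =>
          simp only [fundamentalCoeff]
          split_ifs <;> linarith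
      · exact le_rfl
    · rw [Fintype.sum_sigma]
      simp [hsum]
    · rintro (⟨j, c⟩ | j)
      · have hl : ((⟨2 * n j - 2, by have := hn j; omega⟩ : Fin (2 * n j - 1)) : ℕ) =
          2 * n j - 2 := rfl
        rw [sum_mul_joinVertex_inl w j hl]
        by_cases hj : j = i
        · subst hj
          have hnj := hn j
          simp only [w, if_true, fundamentalCoeff, reeveApex, X, Sum.elim_inl]
          rw [if_neg (show ¬ 2 * n j - 2 < n j - 1 by omega)]
          split_ifs
          · push_cast; ring
          · push_cast; linarith
          · omega
          · push_cast; linarith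
        · simp [w, X, hj]
      · rw [sum_mul_joinVertex_inr, hsum]
        simp only [X, Sum.elim_inr]
        split_ifs <;> simp
  calc q i = (X '' (Finset.Icc 1 (q i) : Set ℕ)).ncard := by
        rw [Set.ncard_image_of_injective _ hinj, Set.ncard_coe_finset, Nat.card_Icc]
        omega
    _ ≤ _ := Set.ncard_le_ncard hsub (finite_lattice_points hn (hn i))

end Count

/-! ### Choice of the parameters -/

theorem exists_ehrhart_sq_lt {k : ℕ} {n : Fin k → ℕ} (hn : ∀ i, 3 ≤ n i) (hmono : Monotone n) :
    ∃ q : Fin k → ℕ, (∀ i, 1 ≤ q i) ∧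
      ∀ i, ehrhart (latticeJoin fun i => reeveSimplex (q i) (n i)) (n i - 1) ^ 2 <
        ehrhart (latticeJoin fun i => reeveSimplex (q i) (n i)) (n i - 2) *
          ehrhart (latticeJoin fun i => reeveSimplex (q i) (n i)) (n i) := by
  have hn1 : ∀ i, 1 ≤ n i := fun i => by have := hn i; omega
  let C := Fintype.card (Σ i, Option (Fin (2 * n i - 1)))
  -- `F Q` exceeds the square of the bound for `E(n i - 1)` when `Q` is a common denominator of the
  -- blocks before the `i`-th one; `Q i` is the product of the `q j + 1` with `j < i`.
  let F : ℕ → ℕ := fun Q => ((∑ i, n i) * Q + 1) ^ (C * 2) + 1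
  let Q : ℕ → ℕ := Nat.rec 1 fun _ Q => Q * (F Q + 1)
  have hQsucc : ∀ a, Q (a + 1) = Q a * (F (Q a) + 1) := fun _ => rfl
  have hQpos : ∀ a, 1 ≤ Q a := by
    intro a
    induction a with
    | zero => exact le_rfl
    | succ a ih => rw [hQsucc]; exact Nat.mul_pos ih (Nat.succ_pos _)
  have hQdvd : ∀ a b, a < b → F (Q a) + 1 ∣ Q b := by
    intro a b hab
    induction b, hab using Nat.le_induction with
    | base => exact ⟨Q a, by rw [hQsucc, mul_comm]⟩
    | succ b _ ih => rw [hQsucc]; exact ih.mul_right _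
  refine ⟨fun i => F (Q i), fun i => Nat.succ_pos _, fun i => ?_⟩
  have : Nonempty (Fin k) := ⟨i⟩
  have hni := hn i
  have hupper := (finite_and_ehrhart_le (q := fun i : Fin k => F (Q i)) hn1
    (show 1 ≤ n i - 1 by omega) (hQpos i) fun j => by
      rcases lt_or_ge j i with hji | hij
      · exact .inl (hQdvd j i hji)
      · have := hmono hij
        exact .inr (by omega)).2
  have hone := one_le_ehrhart (q := fun i : Fin k => F (Q i)) hn1 (show 1 ≤ n i - 2 by omega)
  have hlower := le_ehrhart (q := fun i : Fin k => F (Q i)) hn1 i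
  refine lt_of_le_of_lt (Nat.pow_le_pow_left hupper 2) (lt_of_lt_of_le ?_
    (hlower.trans (Nat.le_mul_of_pos_left _ hone)))
  rw [← pow_mul]
  refine Nat.lt_succ_of_le (Nat.pow_le_pow_left ?_ _)
  gcongr
  exact (Nat.sub_le _ _).trans (Finset.single_le_sum (fun _ _ => Nat.zero_le _) (Finset.mem_univ i))

theorem mainTheorem2 :
    (∀ k : ℕ, 1 ≤ k →
      ∃ (ι : Type) (_ : Fintype ι) (P : Set (ι → ℝ)), IsLatticePolytope P ∧
        ∃ M : Finset ℕ, k ≤ M.card ∧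
          ∀ m ∈ M, 1 ≤ m ∧ ehrhart P m ^ 2 < ehrhart P (m - 1) * ehrhart P (m + 1)) ∧
    (∀ k : ℕ, 2 ≤ k →
      ∃ q : Fin k → ℕ, (∀ i, 1 ≤ q i) ∧
        IsLatticePolytope (latticeJoin fun i => reeveSimplex (q i) (reeveIndex k i)) ∧
        polytopeDim (latticeJoin fun i => reeveSimplex (q i) (reeveIndex k i)) + 1 =
          ∑ i, 2 * reeveIndex k i ∧
        ∀ i, ehrhart (latticeJoin fun i => reeveSimplex (q i) (reeveIndex k i))
              (reeveIndex k i - 1) ^ 2 <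
            ehrhart (latticeJoin fun i => reeveSimplex (q i) (reeveIndex k i))
              (reeveIndex k i - 2) *
            ehrhart (latticeJoin fun i => reeveSimplex (q i) (reeveIndex k i))
              (reeveIndex k i)) := by
  have joins : ∀ k : ℕ, 2 ≤ k →
      ∃ q : Fin k → ℕ, (∀ i, 1 ≤ q i) ∧
        IsLatticePolytope (latticeJoin fun i => reeveSimplex (q i) (reeveIndex k i)) ∧
        polytopeDim (latticeJoin fun i => reeveSimplex (q i) (reeveIndex k i)) + 1 =
          ∑ i, 2 * reeveIndex k i ∧
        ∀ i, ehrhart (latticeJoin fun i => reeveSimplex (q i) (reeveIndex k i))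
              (reeveIndex k i - 1) ^ 2 <
            ehrhart (latticeJoin fun i => reeveSimplex (q i) (reeveIndex k i))
              (reeveIndex k i - 2) *
            ehrhart (latticeJoin fun i => reeveSimplex (q i) (reeveIndex k i))
              (reeveIndex k i) := by
    intro k hk
    have hn : ∀ i, 3 ≤ reeveIndex k i := fun i => by unfold reeveIndex; omega
    have hn1 : ∀ i, 1 ≤ reeveIndex k i := fun i => le_trans (by norm_num) (hn i)
    have : Nonempty (Fin k) := ⟨⟨0, by omega⟩⟩
    obtain ⟨q, hq, hlt⟩ := exists_ehrhart_sq_lt hn fun i j hij => by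
      have : (i : ℕ) ≤ j := hij
      unfold reeveIndex
      omega
    exact ⟨q, hq, isLatticePolytope_latticeJoin_reeveSimplex hn1,
      polytopeDim_latticeJoin_reeveSimplex hn1, hlt⟩
  refine ⟨fun k hk => ?_, joins⟩
  obtain ⟨q, -, hP, -, hlt⟩ := joins (k + 1) (by omega)
  refine ⟨_, inferInstance, _, hP, Finset.univ.image fun i => reeveIndex (k + 1) i - 1, ?_, ?_⟩
  · rw [Finset.card_image_of_injective, Finset.card_univ, Fintype.card_fin]
    · exact Nat.le_succ k
    · intro i j hij
      simp only [reeveIndex] at hij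
      ext
      omega
  · intro m hm
    obtain ⟨i, -, rfl⟩ := Finset.mem_image.1 hm
    have hn : 4 ≤ reeveIndex (k + 1) i := by unfold reeveIndex; omega
    refine ⟨by omega, ?_⟩
    have h := hlt i
    rwa [show reeveIndex (k + 1) i - 1 - 1 = reeveIndex (k + 1) i - 2 by omega,
      show reeveIndex (k + 1) i - 1 + 1 = reeveIndex (k + 1) i by omega]
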